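/- All Banach lattices are real, and $C_0(L)$ denotes the Banach lattice of real-valued continuous functions on $L$ vanishing at infinity, with the pointwise order and the supremum norm. For Banach lattices $X,Y$ let $L(X,Y)$ be the space of bounded linear operators with the operator norm, and let $S_E$ denote the unit sphere of a normed space $E$; an operator $T\in L(X,Y)$ is positive if $Tx\ge 0$ whenever $x\ge 0$. A Banach lattice $Y$ is *uniformly monotone* if for every $0<\varepsilon<1$ there is $0<\delta(\varepsilon)\le\varepsilon$ such that, for all $x,y\ge 0$ in $Y$, $\|x\|=1$ and $\|x+y\|\le 1+\delta(\varepsilon)$ imply $\|y\|\le\varepsilon$; a function $\varepsilon\mapsto\delta(\varepsilon)$ with this property is called a *modulus of uniform monotonicity* of $Y$. The pair $(X,Y)$ has the *Bishop–Phelps–Bollobás property for positive operators* if for every $0<\varepsilon<1$ there is $0<\eta(\varepsilon)<\varepsilon$ such that, for every positive $S\in S_{L(X,Y)}$ and every $x_0\in S_X$ with $\|S(x_0)\|>1-\eta(\varepsilon)$, there exist $u_0\in S_X$ and a positive $T\in S_{L(X,Y)}$ with $$\|T(u_0)\|=1,\qquad \|u_0-x_0\|<\varepsilon,\qquad \|T-S\|<\varepsilon.$$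 **Corollary.** Let $L$ be a locally compact Hausdorff space such that $C_0(L)$ is separable, and let $Y$ be a uniformly monotone Banach lattice. Then the pair $(C_0(L),Y)$ has the Bishop–Phelps–Bollobás property for positive operators. Moreover, the function $\eta$ depends only on the modulus of uniform monotonicity of $Y$: for every function $\delta$ there is a function $\eta$ with $0<\eta(\varepsilon)<\varepsilon$ for $0<\varepsilon<1$ which satisfies the definition of this property for all pairs $(C_0(L),Y)$ such that $L$ is a locally compact Hausdorff space with $C_0(L)$ separable and $Y$ is a Banach lattice having $\delta$ as a modulus of uniform monotonicity. -/

import Mathlib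

universe u v

open scoped ZeroAtInfty

namespace BPBPositive

section ZeroAtInftyLattice

/-! `C₀(L, ℝ)` with the pointwise order and the supremum norm is a Banach lattice. -/

variable {L : Type*} [TopologicalSpace L]

instance instPartialOrderC0 : PartialOrder C₀(L, ℝ) :=
  PartialOrder.lift (fun f : C₀(L, ℝ) => (f : L → ℝ)) DFunLike.coe_injective

theorem c0_le_def {f g : C₀(L, ℝ)} : f ≤ g ↔ ∀ t, f t ≤ g t := Iff.rfl

instance instMaxC0 : Max C₀(L, ℝ) where
  max f g :=
    { toFun := fun t => f t ⊔ g t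
      continuous_toFun := (map_continuous f).sup (map_continuous g)
      zero_at_infty' := by
        simpa using (zero_at_infty f).max (zero_at_infty g) }

instance instMinC0 : Min C₀(L, ℝ) where
  min f g :=
    { toFun := fun t => f t ⊓ g t
      continuous_toFun := (map_continuous f).inf (map_continuous g)
      zero_at_infty' := by
        simpa using (zero_at_infty f).min (zero_at_infty g) }

theorem c0_sup_apply (f g : C₀(L, ℝ)) (t : L) : (f ⊔ g) t = f t ⊔ g t := rfl

theorem c0_inf_apply (f g : C₀(L, ℝ)) (t : L) : (f ⊓ g) t = f t ⊓ g t := rfl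

instance instLatticeC0 : Lattice C₀(L, ℝ) where
  __ := instPartialOrderC0
  sup f g := f ⊔ g
  inf f g := f ⊓ g
  le_sup_left _ _ := c0_le_def.2 fun _ => le_sup_left
  le_sup_right _ _ := c0_le_def.2 fun _ => le_sup_right
  sup_le _ _ _ h₁ h₂ := c0_le_def.2 fun t => sup_le (h₁ t) (h₂ t)
  inf_le_left _ _ := c0_le_def.2 fun _ => inf_le_left
  inf_le_right _ _ := c0_le_def.2 fun _ => inf_le_right
  le_inf _ _ _ h₁ h₂ := c0_le_def.2 fun t => le_inf (h₁ t) (h₂ t)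

instance instIsOrderedAddMonoidC0 : IsOrderedAddMonoid C₀(L, ℝ) where
  add_le_add_left _ _ h c := c0_le_def.2 fun t => add_le_add_left (h t) (c t)

instance instIsOrderedModuleC0 : IsOrderedModule ℝ C₀(L, ℝ) where
  smul_le_smul_of_nonneg_left _ ha _ _ h :=
    c0_le_def.2 fun t => mul_le_mul_of_nonneg_left (h t) ha
  smul_le_smul_of_nonneg_right _ hf _ _ h :=
    c0_le_def.2 fun t => mul_le_mul_of_nonneg_right h (hf t)

theorem c0_abs_apply (f : C₀(L, ℝ)) (t : L) : |f| t = |f t| := rfl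

instance instHasSolidNormC0 : HasSolidNorm C₀(L, ℝ) where
  solid f g h := by
    rw [← ZeroAtInftyContinuousMap.norm_toBCF_eq_norm (f := f),
      ← ZeroAtInftyContinuousMap.norm_toBCF_eq_norm (f := g)]
    refine (BoundedContinuousFunction.norm_le (norm_nonneg _)).2 fun t => ?_
    exact (h t).trans (g.toBCF.norm_coe_le_norm t)

end ZeroAtInftyLattice

section UniformMonotonicity

variable (Y : Type*) [NormedAddCommGroup Y] [Lattice Y]

/-- The implication `x, y ≥ 0, ‖x‖ = 1, ‖x + y‖ ≤ 1 + δ ⇒ ‖y‖ ≤ ε`, for given numbers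
`ε` and `δ`. -/
def UniformMonotonicityAt (ε δ : ℝ) : Prop :=
  ∀ x y : Y, 0 ≤ x → 0 ≤ y → ‖x‖ = 1 → ‖x + y‖ ≤ 1 + δ → ‖y‖ ≤ ε

/-- Uniform monotonicity of a Banach lattice. -/
def UniformlyMonotone : Prop :=
  ∀ ε : ℝ, 0 < ε → ε < 1 → ∃ δ : ℝ, 0 < δ ∧ δ ≤ ε ∧ UniformMonotonicityAt Y ε δ

/-- The function `δ` (only its values on `(0, 1)` matter) is a modulus of uniform monotonicity
of `Y`: it satisfies the definition of uniform monotonicity. -/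
def IsModulusOfUniformMonotonicity (δ : ℝ → ℝ) : Prop :=
  ∀ ε : ℝ, 0 < ε → ε < 1 → 0 < δ ε ∧ δ ε ≤ ε ∧ UniformMonotonicityAt Y ε (δ ε)

end UniformMonotonicity

section BishopPhelpsBollobas

variable (X Y : Type*) [NormedAddCommGroup X] [NormedSpace ℝ X] [Lattice X]
  [NormedAddCommGroup Y] [NormedSpace ℝ Y] [Lattice Y]

variable {X Y} in
/-- A bounded linear operator is positive if it maps positive elements to positive elements. -/
def IsPositiveOperator (S : X →L[ℝ] Y) : Prop := ∀ x : X, 0 ≤ x → 0 ≤ S x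

/-- The condition of the Bishop-Phelps-Bollobás property for positive operators, for given
numbers `ε` and `η`. -/
def BPBpPositiveAt (ε η : ℝ) : Prop :=
  ∀ S : X →L[ℝ] Y, ‖S‖ = 1 → IsPositiveOperator S →
    ∀ x₀ : X, ‖x₀‖ = 1 → 1 - η < ‖S x₀‖ →
      ∃ (u₀ : X) (T : X →L[ℝ] Y), ‖u₀‖ = 1 ∧ ‖T‖ = 1 ∧ IsPositiveOperator T ∧
        ‖T u₀‖ = 1 ∧ ‖u₀ - x₀‖ < ε ∧ ‖T - S‖ < ε

/-- The pair `(X, Y)` of Banach lattices has the Bishop-Phelps-Bollobás property for positive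
operators. -/
def BPBpPositive : Prop :=
  ∀ ε : ℝ, 0 < ε → ε < 1 → ∃ η : ℝ, 0 < η ∧ η < ε ∧ BPBpPositiveAt X Y ε η

end BishopPhelpsBollobas

end BPBPositive

namespace BPBPositive

open Filter Topology

/-! ### Uniform monotonicity and band projections -/

section BanachLattice

variable {Y : Type*} [NormedAddCommGroup Y] [NormedSpace ℝ Y]
  [Lattice Y] [IsOrderedAddMonoid Y] [IsOrderedModule ℝ Y] [HasSolidNorm Y]

/-! Let `S` be positive of norm one and nearly attain its norm at `x`. Choose cutoffs `A`, `B`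
living where `x` is near `1` and near `-1`, and a perturbation `w` of `x` equal to `±1` there. With
complementary band projections `P`, `Q` separating `S A` from `S B`, put `T f = P (S (A f)) + Q (S
(B f))`. For `‖f‖ ≤ 1` positivity gives `|T f| ≤ P (S A) + Q (S B)`, and disjointness makes the
right side equal to `|T w|`; so `T` attains its norm at `w`, and it remains to normalize.

Uniform monotonicity makes `T - S` small in two ways. Since `|S x| + 2 (S x⁺ ⊓ S x⁻) = S |x|` has
norm at most one, `S x⁺` and `S x⁻` are almost disjoint, hence so are `S A` and `S B`, and the
projections lose little. Since `|x| + (d / 2) (1 - A - B) ≤ 1`, the operator `S` is small on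
functions dominated by `1 - A - B`. Both estimates use one value of the modulus, which is why `η`
depends on it alone.

Uniform monotonicity also yields the projections (`UniformlyMonotone.exists_bandProjection`),
through convergence of increasing order bounded sequences. -/

omit [NormedSpace ℝ Y] [IsOrderedModule ℝ Y] in
theorem norm_le_norm_of_nonneg_of_le {x y : Y} (hx : 0 ≤ x) (hxy : x ≤ y) : ‖x‖ ≤ ‖y‖ :=
  norm_le_norm_of_abs_le_abs <| by rwa [abs_of_nonneg hx, abs_of_nonneg (hx.trans hxy)]

omit [HasSolidNorm Y] [IsOrderedAddMonoid Y] in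
theorem UniformMonotonicityAt.norm_le_mul {ε δ : ℝ} (h : UniformMonotonicityAt Y ε δ)
    {x y : Y} (hx : 0 ≤ x) (hy : 0 ≤ y) (hx0 : x ≠ 0) (hxy : ‖x + y‖ ≤ (1 + δ) * ‖x‖) :
    ‖y‖ ≤ ε * ‖x‖ := by
  have hpos : 0 < ‖x‖ := norm_pos_iff.2 hx0
  have hinv : 0 ≤ ‖x‖⁻¹ := by positivity
  have key := h (‖x‖⁻¹ • x) (‖x‖⁻¹ • y) (smul_nonneg hinv hx) (smul_nonneg hinv hy)
    (by rw [norm_smul, norm_inv, norm_norm, inv_mul_cancel₀ hpos.ne'])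
    (by rw [← smul_add, norm_smul, norm_inv, norm_norm, inv_mul_le_iff₀ hpos, mul_comm]
        exact hxy)
  rw [norm_smul, norm_inv, norm_norm, inv_mul_le_iff₀ hpos] at key
  rwa [mul_comm]

-- The threshold `1 - δ / 2` works because `(1 + δ) (1 - δ / 2) ≥ 1` for `δ ≤ 1`. This is the source
-- of `η = δ / 2`.
omit [HasSolidNorm Y] [IsOrderedAddMonoid Y] in
theorem UniformMonotonicityAt.norm_le_of_norm_add_le_one {ε δ : ℝ}
    (h : UniformMonotonicityAt Y ε δ) (hε : 0 ≤ ε) (hδ : 0 < δ) (hδ1 : δ ≤ 1)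
    {x y : Y} (hx : 0 ≤ x) (hy : 0 ≤ y) (hx1 : 1 - δ / 2 < ‖x‖) (hxy : ‖x + y‖ ≤ 1)
    (hx2 : ‖x‖ ≤ 1) : ‖y‖ ≤ ε := by
  have hx0 : x ≠ 0 := by
    rintro rfl
    rw [norm_zero] at hx1
    linarith
  have := h.norm_le_mul hx hy hx0 (hxy.trans (by nlinarith))
  nlinarith

/-- In a uniformly monotone Banach lattice, increasing order bounded sequences of positive
elements converge. -/
theorem UniformlyMonotone.exists_tendsto_of_monotone [CompleteSpace Y] (hY : UniformlyMonotone Y)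
    {x : ℕ → Y} {y : Y} (hx : Monotone x) (h0 : ∀ n, 0 ≤ x n) (hy : ∀ n, x n ≤ y) :
    ∃ l, Tendsto x atTop (𝓝 l) := by
  refine cauchySeq_tendsto_of_complete (Metric.cauchySeq_iff'.2 fun ε hε => ?_)
  have hmono : Monotone fun n => ‖x n‖ := fun m n hmn =>
    norm_le_norm_of_nonneg_of_le (h0 m) (hx hmn)
  have hbdd : BddAbove (Set.range fun n => ‖x n‖) :=
    ⟨‖y‖, by rintro _ ⟨n, rfl⟩; exact norm_le_norm_of_nonneg_of_le (h0 n) (hy n)⟩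
  have hlim := tendsto_atTop_ciSup hmono hbdd
  have hle : ∀ n, ‖x n‖ ≤ ⨆ n, ‖x n‖ := fun n => le_ciSup hbdd n
  set r := ⨆ n, ‖x n‖
  have hr : 0 ≤ r := (norm_nonneg _).trans (hle 0)
  obtain ⟨δ, hδ, -, hUM⟩ := hY (min (1 / 2) (ε / (2 * (r + 1))))
    (lt_min (by norm_num) (by positivity)) ((min_le_left _ _).trans_lt (by norm_num))
  obtain hr0 | hr0 := hr.eq_or_lt
  · have hz : ∀ n, x n = 0 := fun n => norm_le_zero_iff.1 ((hle n).trans_eq hr0.symm)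
    exact ⟨0, fun n _ => by simpa [hz] using hε⟩
  -- The norms increase to `r`, so from some `N` on they exceed `‖x N‖` by a factor of at most `1 +
  -- δ`; uniform monotonicity then bounds the increments `x n - x N`.
  obtain ⟨N, hN⟩ := ((hlim.const_mul (1 + δ)).eventually
    (lt_mem_nhds (show r < (1 + δ) * r by nlinarith))).exists
  refine ⟨N, fun n hn => ?_⟩
  have hN0 : x N ≠ 0 := by
    intro h
    rw [h, norm_zero, mul_zero] at hN
    linarith
  have key := hUM.norm_le_mul (h0 N) (sub_nonneg.2 (hx hn)) hN0
    (by rw [add_sub_cancel]; exact (hle n).trans hN.le)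
  rw [dist_eq_norm]
  calc ‖x n - x N‖ ≤ min (1 / 2) (ε / (2 * (r + 1))) * ‖x N‖ := key
    _ ≤ ε / (2 * (r + 1)) * (r + 1) :=
        mul_le_mul (min_le_right _ _) ((hle N).trans (by linarith)) (norm_nonneg _)
          (by positivity)
    _ = ε / 2 := by field_simp
    _ < ε := by linarith

omit [IsOrderedModule ℝ Y] in
/-- An additive function on the positive cone lying between `0` and the identity extends to a
bounded linear operator. -/
theorem exists_continuousLinearMap_of_add {p : Y → Y} (h0 : ∀ x, 0 ≤ x → 0 ≤ p x)
    (hle : ∀ x, 0 ≤ x → p x ≤ x) (hadd : ∀ x y, 0 ≤ x → 0 ≤ y → p (x + y) = p x + p y) :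
    ∃ P : Y →L[ℝ] Y, ∀ x, 0 ≤ x → P x = p x := by
  have hp0 : p 0 = 0 := (hle 0 le_rfl).antisymm (h0 0 le_rfl)
  have hadd' : ∀ x y : Y, p (x + y)⁺ - p (x + y)⁻ = (p x⁺ - p x⁻) + (p y⁺ - p y⁻) := by
    intro x y
    -- Both sides are sums of positive elements, where additivity of `p` is available.
    have h : (x + y)⁺ + (x⁻ + y⁻) = (x + y)⁻ + (x⁺ + y⁺) := by
      have h1 := posPart_sub_negPart (x + y)
      have h2 := posPart_sub_negPart x
      have h3 := posPart_sub_negPart y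
      rw [sub_eq_iff_eq_add] at h1
      rw [h1]
      nth_rewrite 1 [← h2]
      nth_rewrite 1 [← h3]
      abel
    have h' := congrArg p h
    rw [hadd _ _ (posPart_nonneg _) (add_nonneg (negPart_nonneg _) (negPart_nonneg _)),
      hadd _ _ (negPart_nonneg _) (add_nonneg (posPart_nonneg _) (posPart_nonneg _)),
      hadd _ _ (negPart_nonneg _) (negPart_nonneg _),
      hadd _ _ (posPart_nonneg _) (posPart_nonneg _)] at h'
    rw [← sub_eq_zero] at h' ⊢
    rw [← h']
    abel
  let f : Y →+ Y := AddMonoidHom.mk' (fun x => p x⁺ - p x⁻) hadd'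
  have hf : Continuous f := AddMonoidHomClass.continuous_of_bound f 1 fun x => by
    rw [one_mul]
    refine norm_le_norm_of_abs_le_abs ?_
    change |p x⁺ - p x⁻| ≤ |x|
    have h1 := h0 _ (posPart_nonneg x)
    have h2 := h0 _ (negPart_nonneg x)
    calc |p x⁺ - p x⁻| ≤ p x⁺ + p x⁻ :=
          abs_le'.2 ⟨(sub_le_self _ h2).trans (le_add_of_nonneg_right h2), by
            rw [neg_sub]; exact (sub_le_self _ h1).trans (le_add_of_nonneg_left h1)⟩
      _ ≤ x⁺ + x⁻ := add_le_add (hle _ (posPart_nonneg x)) (hle _ (negPart_nonneg x))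
      _ = |x| := posPart_add_negPart x
  -- Homogeneity need not be checked: a continuous additive map is real linear.
  refine ⟨f.toRealLinearMap hf, fun x hx => ?_⟩
  change p x⁺ - p x⁻ = p x
  rw [posPart_of_nonneg hx, negPart_of_nonneg hx, hp0, sub_zero]

omit [NormedSpace ℝ Y] [IsOrderedModule ℝ Y] [HasSolidNorm Y] in
theorem inf_add_le_inf_add_inf {x y z : Y} (hx : 0 ≤ x) (hy : 0 ≤ y) (hz : 0 ≤ z) :
    (x + y) ⊓ z ≤ x ⊓ z + y ⊓ z := by
  rw [add_inf, inf_add, inf_add]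
  refine le_inf (le_inf inf_le_left ?_) (le_inf ?_ ?_)
  · exact inf_le_right.trans (le_add_of_nonneg_right hy)
  · exact inf_le_right.trans (le_add_of_nonneg_left hx)
  · exact inf_le_right.trans (le_add_of_nonneg_left hz)

omit [NormedSpace ℝ Y] [IsOrderedModule ℝ Y] [HasSolidNorm Y] in
theorem inf_nsmul_eq_zero {x e : Y} (hx : 0 ≤ x) (he : 0 ≤ e) (h : x ⊓ e = 0) (n : ℕ) :
    x ⊓ n • e = 0 := by
  induction n with
  | zero => simpa using hx
  | succ n ih =>
    refine le_antisymm ?_ (le_inf hx (nsmul_nonneg he _))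
    rw [succ_nsmul, inf_comm]
    refine (inf_add_le_inf_add_inf (nsmul_nonneg he n) he hx).trans ?_
    rw [inf_comm, ih, inf_comm, h, add_zero]

/-- The band projection associated with a positive element of a uniformly monotone Banach
lattice. -/
theorem UniformlyMonotone.exists_bandProjection [CompleteSpace Y] (hY : UniformlyMonotone Y)
    {e : Y} (he : 0 ≤ e) :
    ∃ P : Y →L[ℝ] Y, (∀ x, 0 ≤ x → 0 ≤ P x) ∧ (∀ x, 0 ≤ x → P x ≤ x) ∧ P e = e ∧
      (∀ x, 0 ≤ x → x ⊓ e = 0 → P x = 0) ∧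
      ∀ x y, 0 ≤ x → 0 ≤ y → P x ⊓ (y - P y) = 0 := by
  have hne : ∀ n : ℕ, 0 ≤ n • e := fun n => nsmul_nonneg he n
  -- On the positive cone the projection is the limit of `x ⊓ n • e`; the value `0` elsewhere is a
  -- dummy.
  have hex : ∀ x : Y, ∃ l, 0 ≤ x → Tendsto (fun n : ℕ => x ⊓ n • e) atTop (𝓝 l) := by
    intro x
    by_cases hx : 0 ≤ x
    · obtain ⟨l, hl⟩ := hY.exists_tendsto_of_monotone (x := fun n : ℕ => x ⊓ n • e) (y := x)
        (fun m n hmn => inf_le_inf_left _ (nsmul_le_nsmul_left he hmn))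
        (fun n => le_inf hx (hne n)) (fun n => inf_le_left)
      exact ⟨l, fun _ => hl⟩
    · exact ⟨0, fun h => absurd h hx⟩
  choose p hp using hex
  have hmem : ∀ x, 0 ≤ x → ∀ n : ℕ, x ⊓ n • e ≤ p x := fun x hx n =>
    Monotone.ge_of_tendsto
      (fun m n hmn => inf_le_inf_left _ (nsmul_le_nsmul_left he hmn)) (hp x hx) n
  have h0 : ∀ x, 0 ≤ x → 0 ≤ p x := fun x hx =>
    ge_of_tendsto' (hp x hx) fun n => le_inf hx (hne n)
  have hle : ∀ x, 0 ≤ x → p x ≤ x := fun x hx => le_of_tendsto' (hp x hx) fun n => inf_le_left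
  have hadd : ∀ x y, 0 ≤ x → 0 ≤ y → p (x + y) = p x + p y := by
    intro x y hx hy
    have hxy := add_nonneg hx hy
    refine le_antisymm ?_ ?_
    · exact le_of_tendsto' (hp _ hxy) fun n =>
        (inf_add_le_inf_add_inf hx hy (hne n)).trans (add_le_add (hmem x hx n) (hmem y hy n))
    · refine le_of_tendsto' ((hp x hx).add (hp y hy)) fun n => ?_
      refine (le_inf (add_le_add inf_le_left inf_le_left) ?_).trans (hmem _ hxy (n + n))
      rw [add_nsmul]
      exact add_le_add inf_le_right inf_le_right
  have hdisj : ∀ y, 0 ≤ y → (y - p y) ⊓ e = 0 := by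
    intro y hy
    refine le_antisymm ?_ (le_inf (sub_nonneg.2 (hle y hy)) he)
    -- The left side lies below `y ⊓ (n + 1) • e`. Letting `n` tend to infinity gives `(y - p y) ⊓ e
    -- + p y ≤ p y`.
    have h : ∀ n : ℕ, (y - p y) ⊓ e + y ⊓ n • e ≤ p y := fun n => by
      refine (le_inf ?_ ?_).trans (hmem y hy (n + 1))
      · calc (y - p y) ⊓ e + y ⊓ n • e ≤ (y - p y) + p y := add_le_add inf_le_left (hmem y hy n)
          _ = y := sub_add_cancel _ _
      · rw [succ_nsmul']
        exact add_le_add inf_le_right inf_le_right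
    have := le_of_tendsto' ((hp y hy).const_add ((y - p y) ⊓ e)) h
    simpa using this
  have hdisjn : ∀ y, 0 ≤ y → ∀ n : ℕ, (y - p y) ⊓ n • e = 0 := fun y hy =>
    inf_nsmul_eq_zero (sub_nonneg.2 (hle y hy)) he (hdisj y hy)
  obtain ⟨P, hP⟩ := exists_continuousLinearMap_of_add h0 hle hadd
  refine ⟨P, fun x hx => hP x hx ▸ h0 x hx, fun x hx => hP x hx ▸ hle x hx, ?_, ?_, ?_⟩
  · rw [hP e he]
    refine (hle e he).antisymm ?_
    simpa using hmem e he 1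
  · intro x hx hxe
    rw [hP x hx]
    refine tendsto_nhds_unique (hp x hx) ?_
    simp [inf_nsmul_eq_zero hx he hxe]
  · intro x y hx hy
    rw [hP x hx, hP y hy]
    have h : Tendsto (fun n : ℕ => (x ⊓ n • e) ⊓ (y - p y)) atTop (𝓝 (p x ⊓ (y - p y))) :=
      (hp x hx).inf_nhds tendsto_const_nhds
    refine tendsto_nhds_unique h ?_
    have : ∀ n : ℕ, (x ⊓ n • e) ⊓ (y - p y) = 0 := fun n => by
      rw [inf_assoc, inf_comm (n • e), hdisjn y hy n]
      exact inf_eq_right.2 hx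
    simp [this]

end BanachLattice

/-! ### Positive operators and complementary projections -/

section PositiveOperators

variable {X Y : Type*} [NormedAddCommGroup X] [NormedSpace ℝ X] [Lattice X]
  [IsOrderedAddMonoid X]
  [NormedAddCommGroup Y] [NormedSpace ℝ Y] [Lattice Y] [IsOrderedAddMonoid Y]

theorem IsPositiveOperator.mono {S : X →L[ℝ] Y} (hS : IsPositiveOperator S) {x y : X}
    (h : x ≤ y) : S x ≤ S y := by
  have := hS _ (sub_nonneg.2 h)
  rwa [map_sub, sub_nonneg] at this

theorem IsPositiveOperator.abs_apply_le {S : X →L[ℝ] Y} (hS : IsPositiveOperator S) {x y : X}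
    (h : |x| ≤ y) : |S x| ≤ S y := by
  refine abs_le'.2 ⟨hS.mono ((le_abs_self x).trans h), ?_⟩
  rw [← map_neg]
  exact hS.mono ((neg_le_abs x).trans h)

theorem IsPositiveOperator.norm_apply_le [HasSolidNorm Y] {S : X →L[ℝ] Y}
    (hS : IsPositiveOperator S) {x y : X} (h : |x| ≤ y) : ‖S x‖ ≤ ‖S y‖ :=
  norm_le_norm_of_abs_le_abs ((hS.abs_apply_le h).trans (le_abs_self _))

-- Normalizing moves `T` by `|‖T‖ - 1| = |‖T‖ - ‖S‖|`, which is again at most `‖T - S‖`.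
omit [Lattice X] [IsOrderedAddMonoid X] [Lattice Y] [IsOrderedAddMonoid Y] in
theorem norm_normalize_sub_le {S T : X →L[ℝ] Y} {c : ℝ} (hS : ‖S‖ = 1) (h : ‖T - S‖ ≤ c)
    (hT : 0 < ‖T‖) : ‖‖T‖⁻¹ • T - S‖ ≤ 2 * c := by
  have h1 : ‖‖T‖⁻¹ • T - T‖ ≤ c := by
    have : ‖T‖⁻¹ • T - T = (‖T‖⁻¹ - 1) • T := by rw [sub_smul, one_smul]
    rw [this, norm_smul, Real.norm_eq_abs]
    nth_rewrite 2 [← abs_norm T]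
    rw [← abs_mul, sub_mul, inv_mul_cancel₀ hT.ne', one_mul, ← hS, abs_sub_comm]
    exact (abs_norm_sub_norm_le T S).trans h
  calc ‖‖T‖⁻¹ • T - S‖ ≤ ‖‖T‖⁻¹ • T - T‖ + ‖T - S‖ := norm_sub_le_norm_sub_add_norm_sub _ _ _
    _ ≤ 2 * c := by linarith

omit [NormedSpace ℝ Y] in
theorem abs_sub_add_inf_add_inf (x y : Y) : |x - y| + (x ⊓ y + x ⊓ y) = x + y := by
  have := two_nsmul_inf_eq_add_sub_abs_sub x y
  rw [two_nsmul] at this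
  rw [this, abs_sub_comm]
  abel

/-- Two positive elements of a uniformly monotone Banach lattice are separated, up to their
infimum, by a pair of complementary band projections. -/
theorem UniformlyMonotone.exists_complementary_projections [IsOrderedModule ℝ Y]
    [HasSolidNorm Y] [CompleteSpace Y] (hY : UniformlyMonotone Y) {a b : Y} (ha : 0 ≤ a)
    (hb : 0 ≤ b) :
    ∃ P Q : Y →L[ℝ] Y, IsPositiveOperator P ∧ IsPositiveOperator Q ∧ (∀ x, P x + Q x = x) ∧
      Q a ≤ a ⊓ b ∧ P b ≤ a ⊓ b ∧ |P a - Q b| = P a + Q b := by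
  -- `P` fixes `(a - b)⁺` and kills `(a - b)⁻`, so only parts of `a ⊓ b` survive in `Q a` and `P b`.
  obtain ⟨P, hP0, hP1, hPe, hPd, hPQ⟩ := hY.exists_bandProjection (posPart_nonneg (a - b))
  have hab : 0 ≤ a ⊓ b := le_inf ha hb
  refine ⟨P, ContinuousLinearMap.id ℝ Y - P, hP0, fun x hx => sub_nonneg.2 (hP1 x hx),
    fun x => add_sub_cancel _ _, ?_, ?_, ?_⟩
  · have h : a = a ⊓ b + (a - b)⁺ := by rw [inf_eq_sub_posPart_sub, sub_add_cancel]
    calc a - P a = a ⊓ b - P (a ⊓ b) := by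
          have := congrArg P h
          rw [map_add, hPe] at this
          rw [this]
          nth_rewrite 1 [h]
          abel
      _ ≤ a ⊓ b := sub_le_self _ (hP0 _ hab)
  · have h : b = a ⊓ b + (a - b)⁻ := by
      rw [inf_comm, inf_eq_sub_posPart_sub, ← neg_sub b a, negPart_neg, sub_add_cancel]
    have hz : P (a - b)⁻ = 0 := hPd _ (negPart_nonneg _) (by
      rw [inf_comm]; exact posPart_inf_negPart_eq_zero _)
    have := congrArg P h
    rw [map_add, hz, add_zero] at this
    rw [this]
    exact hP1 _ hab
  · have h := abs_sub_add_inf_add_inf (P a) (b - P b)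
    rwa [hPQ a b ha hb, add_zero, add_zero] at h

end PositiveOperators

/-! ### Cutoff functions in `C₀(L, ℝ)` -/

section ZeroAtInfty

variable {L : Type*} [TopologicalSpace L]

theorem c0_norm_le {f : C₀(L, ℝ)} {C : ℝ} (hC : 0 ≤ C) : ‖f‖ ≤ C ↔ ∀ t, |f t| ≤ C := by
  rw [← ZeroAtInftyContinuousMap.norm_toBCF_eq_norm (f := f)]
  exact BoundedContinuousFunction.norm_le hC

theorem c0_abs_apply_le_norm (f : C₀(L, ℝ)) (t : L) : |f t| ≤ ‖f‖ :=
  (c0_norm_le (norm_nonneg f)).1 le_rfl t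

/-- Composition with a continuous real function vanishing at `0`. -/
def c0CompLeft (g : ℝ → ℝ) (hg : Continuous g) (hg0 : g 0 = 0) (f : C₀(L, ℝ)) : C₀(L, ℝ) where
  toFun t := g (f t)
  continuous_toFun := hg.comp (map_continuous f)
  zero_at_infty' := (hg.tendsto' 0 0 hg0).comp (zero_at_infty f)

/-- A piecewise linear function equal to `0` up to `1 - d` and to `1` from `1 - d / 2` on. -/
noncomputable def ramp (d t : ℝ) : ℝ := min 1 (max 0 ((t - (1 - d)) * (2 / d)))

theorem continuous_ramp (d : ℝ) : Continuous (ramp d) := by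
  unfold ramp; fun_prop

theorem ramp_nonneg (d t : ℝ) : 0 ≤ ramp d t := le_min zero_le_one (le_max_left _ _)

theorem ramp_le_one (d t : ℝ) : ramp d t ≤ 1 := min_le_left _ _

theorem ramp_of_le {d t : ℝ} (hd : 0 < d) (ht : t ≤ 1 - d) : ramp d t = 0 := by
  have : (t - (1 - d)) * (2 / d) ≤ 0 :=
    mul_nonpos_of_nonpos_of_nonneg (by linarith) (by positivity)
  rw [ramp, max_eq_left this, min_eq_right zero_le_one]

theorem ramp_of_ge {d t : ℝ} (hd : 0 < d) (ht : 1 - d / 2 ≤ t) : ramp d t = 1 := by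
  have : 1 ≤ (t - (1 - d)) * (2 / d) := by
    rw [← mul_div_assoc, le_div_iff₀ hd]
    linarith
  exact min_eq_left (this.trans (le_max_right _ _))

/-- Dilation by `(1 - d)⁻¹`, truncated to `[-1, 1]`. -/
noncomputable def truncatedDilation (d t : ℝ) : ℝ := max (-1) (min 1 (t / (1 - d)))

theorem continuous_truncatedDilation (d : ℝ) : Continuous (truncatedDilation d) := by
  unfold truncatedDilation; fun_prop

theorem abs_truncatedDilation_le (d t : ℝ) : |truncatedDilation d t| ≤ 1 :=
  abs_le.2 ⟨le_max_left _ _, max_le (by norm_num) (min_le_left _ _)⟩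

theorem truncatedDilation_of_ge {d t : ℝ} (hd : d < 1) (ht : 1 - d ≤ t) :
    truncatedDilation d t = 1 := by
  have : 1 ≤ t / (1 - d) := (one_le_div (by linarith)).2 ht
  rw [truncatedDilation, min_eq_left this, max_eq_right (by norm_num)]

theorem truncatedDilation_of_le {d t : ℝ} (hd : d < 1) (ht : t ≤ -(1 - d)) :
    truncatedDilation d t = -1 := by
  have : t / (1 - d) ≤ -1 := by rw [div_le_iff₀ (by linarith)]; linarith
  exact max_eq_left ((min_le_right _ _).trans this)

theorem abs_truncatedDilation_sub_le {d t : ℝ} (hd0 : 0 ≤ d) (hd : d < 1) (ht : |t| ≤ 1) :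
    |truncatedDilation d t - t| ≤ d := by
  obtain ⟨h1, h2⟩ := abs_le.1 ht
  obtain h | h := le_total (1 - d) t
  · rw [truncatedDilation_of_ge hd h, abs_le]
    constructor <;> linarith
  obtain h' | h' := le_total t (-(1 - d))
  · rw [truncatedDilation_of_le hd h', abs_le]
    constructor <;> linarith
  have hpos : 0 < 1 - d := by linarith
  have h3 : t / (1 - d) ≤ 1 := (div_le_one hpos).2 h
  have h4 : -1 ≤ t / (1 - d) := by rw [le_div_iff₀ hpos]; linarith
  have h5 : t / (1 - d) - t = d * (t / (1 - d)) := by field_simp; ring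
  rw [truncatedDilation, min_eq_right h3, max_eq_right h4, h5, abs_mul, abs_of_nonneg hd0]
  exact mul_le_of_le_one_right hd0 (abs_le.2 ⟨h4, h3⟩)

/-- Functions localizing the sets where `x` is near `1` and near `-1`, and a perturbation of `x`
equal to `1`, respectively `-1`, on their supports. -/
theorem exists_cutoffs {x : C₀(L, ℝ)} (hx : ‖x‖ ≤ 1) {d : ℝ} (hd0 : 0 < d) (hd : d ≤ 1 / 2) :
    ∃ A B w : C₀(L, ℝ), 0 ≤ A ∧ 0 ≤ B ∧ (∀ t, A t + B t ≤ 1) ∧ A * w = A ∧ B * w = -B ∧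
      A ≤ x⁺ + x⁺ ∧ B ≤ x⁻ + x⁻ ∧ (∀ t, |x t| + d / 2 * (1 - A t - B t) ≤ 1) ∧
      ‖w‖ ≤ 1 ∧ ‖w - x‖ ≤ d := by
  have hd1 : d < 1 := by linarith
  have hr0 : ramp d 0 = 0 := ramp_of_le hd0 (by linarith)
  have hx1 : ∀ t, |x t| ≤ 1 := (c0_norm_le zero_le_one).1 hx
  -- The ramp is nonzero only for `s > 1 - d ≥ 1 / 2`, where `2 s ≥ 1`; this is where `d ≤ 1 / 2`
  -- enters.
  have hr : ∀ s, ramp d s ≤ max s 0 + max s 0 := fun s => by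
    obtain h | h := le_total s (1 - d)
    · rw [ramp_of_le hd0 h]
      positivity
    · linarith [ramp_le_one d s, le_max_left s 0]
  have hrw : ∀ s, ramp d s * truncatedDilation d s = ramp d s := fun s => by
    obtain h | h := le_total s (1 - d)
    · rw [ramp_of_le hd0 h, zero_mul]
    · rw [truncatedDilation_of_ge hd1 h, mul_one]
  have hrw' : ∀ s, ramp d (-s) * truncatedDilation d s = -ramp d (-s) := fun s => by
    obtain h | h := le_total (-s) (1 - d)
    · rw [ramp_of_le hd0 h, zero_mul, neg_zero]
    · rw [truncatedDilation_of_le hd1 (by linarith), mul_neg_one]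
  refine ⟨c0CompLeft (ramp d) (continuous_ramp d) hr0 x,
    c0CompLeft (ramp d) (continuous_ramp d) hr0 (-x),
    c0CompLeft (truncatedDilation d) (continuous_truncatedDilation d)
      (by simp [truncatedDilation]) x, fun t => ramp_nonneg _ _, fun t => ramp_nonneg _ _, ?_,
    ZeroAtInftyContinuousMap.ext fun t => hrw (x t),
    ZeroAtInftyContinuousMap.ext fun t => hrw' (x t), fun t => hr (x t), fun t => hr (-x t), ?_,
    (c0_norm_le zero_le_one).2 fun t => abs_truncatedDilation_le _ _,
    (c0_norm_le hd0.le).2 fun t => abs_truncatedDilation_sub_le hd0.le hd1 (hx1 t)⟩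
  · intro t
    change ramp d (x t) + ramp d (-x t) ≤ 1
    obtain h | h := le_total (x t) 0
    · rw [ramp_of_le hd0 (h.trans (by linarith)), zero_add]
      exact ramp_le_one _ _
    · rw [ramp_of_le hd0 (show -x t ≤ 1 - d by linarith), add_zero]
      exact ramp_le_one _ _
  · intro t
    change |x t| + d / 2 * (1 - ramp d (x t) - ramp d (-x t)) ≤ 1
    have h1 := ramp_nonneg d (x t)
    have h2 := ramp_nonneg d (-x t)
    -- Either one ramp equals `1` and the added term is not positive, or `|x t|` leaves room `d /
    -- 2`.
    obtain h | h := le_total (1 - d / 2) |x t|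
    · obtain h' | h' := le_abs'.1 h
      · rw [ramp_of_ge hd0 (show 1 - d / 2 ≤ -x t by linarith)]
        nlinarith [hx1 t]
      · rw [ramp_of_ge hd0 h']
        nlinarith [hx1 t]
    · nlinarith

end ZeroAtInfty

/-! ### Construction of the norm attaining operator -/

section Main

variable {L : Type*} [TopologicalSpace L] {Y : Type*} [NormedAddCommGroup Y] [NormedSpace ℝ Y]
  [CompleteSpace Y] [Lattice Y] [IsOrderedAddMonoid Y] [IsOrderedModule ℝ Y] [HasSolidNorm Y]

/-- A positive operator on `C₀(L, ℝ)` which almost attains its norm at `x` is close to a positive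
operator attaining its norm at a point close to `x`. -/
theorem exists_norm_attaining_near (hY : UniformlyMonotone Y) {γ δ d : ℝ} (hγ : 0 ≤ γ)
    (hδ : 0 < δ) (hδ1 : δ ≤ 1) (hUM : UniformMonotonicityAt Y γ δ) (hd0 : 0 < d)
    (hd : d ≤ 1 / 2) {S : C₀(L, ℝ) →L[ℝ] Y} (hS : ‖S‖ = 1) (hS0 : IsPositiveOperator S)
    {x : C₀(L, ℝ)} (hx : ‖x‖ = 1) (hSx : 1 - δ / 2 < ‖S x‖) :
    ∃ (w : C₀(L, ℝ)) (T : C₀(L, ℝ) →L[ℝ] Y), ‖w‖ ≤ 1 ∧ IsPositiveOperator T ∧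
      ‖T‖ ≤ ‖T w‖ ∧ ‖w - x‖ ≤ d ∧ ‖T - S‖ ≤ 4 * γ + 2 * γ / d := by
  obtain ⟨A, B, w, hA, hB, hAB, hAw, hBw, hAx, hBx, hdec, hw, hwx⟩ := exists_cutoffs hx.le hd0 hd
  have hSle : ∀ f, ‖S f‖ ≤ ‖f‖ := fun f => by simpa [hS] using S.le_opNorm f
  obtain ⟨P, Q, hP, hQ, hPQ, hQa, hPb, habs⟩ :=
    hY.exists_complementary_projections (hS0 A hA) (hS0 B hB)
  have hp := hS0 _ (posPart_nonneg x)
  have hq := hS0 _ (negPart_nonneg x)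
  set m := S x⁺ ⊓ S x⁻
  have hm0 : 0 ≤ m := le_inf hp hq
  have hm : ‖m + m‖ ≤ γ := by
    refine hUM.norm_le_of_norm_add_le_one hγ hδ hδ1 (abs_nonneg (S x)) (add_nonneg hm0 hm0)
      ?_ ?_ ?_
    · rwa [norm_abs_eq_norm]
    · have h : |S x| + (m + m) = S |x| := by
        rw [← posPart_add_negPart x, map_add, ← abs_sub_add_inf_add_inf (S x⁺) (S x⁻), ← map_sub,
          posPart_sub_negPart]
      rw [h]
      exact (hSle _).trans ((norm_abs_eq_norm x).trans hx).le
    · rw [norm_abs_eq_norm, ← hx]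
      exact hSle x
  have hinf0 : 0 ≤ S A ⊓ S B := le_inf (hS0 A hA) (hS0 B hB)
  have hinf : ‖S A ⊓ S B‖ ≤ 2 * γ := by
    have h : S A ⊓ S B ≤ (m + m) + (m + m) := by
      have hA' := hS0.mono hAx
      have hB' := hS0.mono hBx
      rw [map_add] at hA' hB'
      refine (inf_le_inf hA' hB').trans ((inf_add_le_inf_add_inf hp hp (add_nonneg hq hq)).trans ?_)
      have h' : S x⁺ ⊓ (S x⁻ + S x⁻) ≤ m + m := by
        rw [inf_comm]
        refine (inf_add_le_inf_add_inf hq hq hp).trans_eq ?_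
        rw [inf_comm]
      exact add_le_add h' h'
    refine (norm_le_norm_of_nonneg_of_le hinf0 h).trans ((norm_add_le _ _).trans ?_)
    linarith
  let T : C₀(L, ℝ) →L[ℝ] Y := (P.comp S).comp (ContinuousLinearMap.mul ℝ _ A) +
    (Q.comp S).comp (ContinuousLinearMap.mul ℝ _ B)
  have hT : ∀ f, T f = P (S (A * f)) + Q (S (B * f)) := fun f => rfl
  have hmul : ∀ {C : C₀(L, ℝ)}, 0 ≤ C → ∀ {f : C₀(L, ℝ)}, ‖f‖ ≤ 1 → |C * f| ≤ C := by
    intro C hC f hf t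
    change |C t * f t| ≤ C t
    rw [abs_mul, abs_of_nonneg (hC t)]
    exact mul_le_of_le_one_right (hC t) ((c0_abs_apply_le_norm f t).trans hf)
  have hPS : IsPositiveOperator (P.comp S) := fun f hf => hP _ (hS0 f hf)
  have hQS : IsPositiveOperator (Q.comp S) := fun f hf => hQ _ (hS0 f hf)
  refine ⟨w, T, hw, ?_, ?_, hwx, ?_⟩
  · intro f hf
    rw [hT]
    exact add_nonneg (hPS _ fun t => mul_nonneg (hA t) (hf t))
      (hQS _ fun t => mul_nonneg (hB t) (hf t))
  · refine T.opNorm_le_of_unit_norm (norm_nonneg _) fun f hf => norm_le_norm_of_abs_le_abs ?_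
    have hTw : T w = P (S A) - Q (S B) := by
      rw [hT, hAw, hBw, map_neg, map_neg, ← sub_eq_add_neg]
    rw [hTw, habs, hT]
    exact (abs_add_le _ _).trans
      (add_le_add (hPS.abs_apply_le (hmul hA hf.le)) (hQS.abs_apply_le (hmul hB hf.le)))
  · refine ContinuousLinearMap.opNorm_le_of_unit_norm (by positivity) fun f hf => ?_
    -- Write `f = A f + B f + r` and use `P + Q = 1`: the error is what each projection discards,
    -- plus the part of `f` off the cutoffs.
    have hsplit : (T - S) f =
        -(Q (S (A * f)) + P (S (B * f)) + S (f - A * f - B * f)) := by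
      have h1 := hPQ (S (A * f))
      have h2 := hPQ (S (B * f))
      rw [sub_apply, hT, map_sub, map_sub]
      rw [← sub_eq_iff_eq_add'.2 h1.symm, ← sub_eq_iff_eq_add'.2 h2.symm]
      abel
    have h1 : ‖Q (S (A * f))‖ ≤ 2 * γ :=
      (hQS.norm_apply_le (hmul hA hf.le)).trans
        ((norm_le_norm_of_nonneg_of_le (hQS A hA) hQa).trans hinf)
    have h2 : ‖P (S (B * f))‖ ≤ 2 * γ :=
      (hPS.norm_apply_le (hmul hB hf.le)).trans
        ((norm_le_norm_of_nonneg_of_le (hPS B hB) hPb).trans hinf)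
    have h3 : ‖S (f - A * f - B * f)‖ ≤ 2 * γ / d := by
      set r := f - A * f - B * f
      have hr : ∀ t, |r t| ≤ 1 - A t - B t := fun t => by
        have hft := (c0_abs_apply_le_norm f t).trans hf.le
        have : r t = (1 - A t - B t) * f t := by
          change f t - A t * f t - B t * f t = _
          ring
        have h0 : 0 ≤ 1 - A t - B t := by linarith [hAB t]
        rw [this, abs_mul, abs_of_nonneg h0]
        exact mul_le_of_le_one_right h0 hft
      have hy : ‖(d / 2) • S |r|‖ ≤ γ := by
        refine hUM.norm_le_of_norm_add_le_one hγ hδ hδ1 (hS0 |x| (abs_nonneg x))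
          (smul_nonneg (by positivity) (hS0 _ (abs_nonneg r))) ?_ ?_ ?_
        · exact hSx.trans_le (hS0.norm_apply_le le_rfl)
        · rw [← map_smul, ← map_add]
          refine (hSle _).trans ((c0_norm_le zero_le_one).2 fun t => ?_)
          change |(|x t| + d / 2 * |r t|)| ≤ 1
          rw [abs_of_nonneg (by positivity)]
          nlinarith [hdec t, hr t]
        · exact (hSle _).trans ((norm_abs_eq_norm x).trans hx).le
      rw [norm_smul, Real.norm_of_nonneg (by positivity)] at hy
      refine (hS0.norm_apply_le le_rfl).trans ?_
      rw [le_div_iff₀ hd0]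
      linarith
    rw [hsplit, norm_neg]
    refine (norm_add_le _ _).trans ?_
    linarith [norm_add_le (Q (S (A * f))) (P (S (B * f)))]

/-- With `γ = ε ^ 2 / 32` and `d = ε / 2` the error `4 γ + 2 γ / d` equals `ε ^ 2 / 8 + ε / 8 ≤ ε /
4`, and normalization at most doubles it. -/
theorem bpbpPositiveAt_of_uniformMonotonicityAt (hY : UniformlyMonotone Y) {ε δ : ℝ}
    (hε : 0 < ε) (hε1 : ε < 1) (hδ : 0 < δ) (hδ1 : δ ≤ 1)
    (hUM : UniformMonotonicityAt Y (ε ^ 2 / 32) δ) :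
    BPBpPositiveAt C₀(L, ℝ) Y ε (δ / 2) := by
  intro S hS hS0 x hx hSx
  obtain ⟨w, T, hw, hT0, hTw, hwx, hTS⟩ := exists_norm_attaining_near hY (d := ε / 2)
    (by positivity) hδ hδ1 hUM (by positivity) (by linarith) hS hS0 hx hSx
  have hc : ‖T - S‖ ≤ ε / 4 := by
    refine hTS.trans ?_
    have : 4 * (ε ^ 2 / 32) + 2 * (ε ^ 2 / 32) / (ε / 2) = ε ^ 2 / 8 + ε / 8 := by
      field_simp
      ring
    rw [this]
    nlinarith
  have hT : 0 < ‖T‖ := by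
    have := norm_sub_norm_le S T
    rw [norm_sub_rev, hS] at this
    linarith
  have hTle := T.le_opNorm w
  refine ⟨w, ‖T‖⁻¹ • T, ?_, ?_, ?_, ?_, ?_, ?_⟩
  -- From `‖T‖ ≤ ‖T w‖ ≤ ‖T‖ ‖w‖` and `‖T‖ > 0` one gets `‖w‖ ≥ 1`.
  · exact hw.antisymm (by nlinarith)
  · rw [norm_smul, norm_inv, Real.norm_of_nonneg hT.le, inv_mul_cancel₀ hT.ne']
  · exact fun f hf => smul_nonneg (by positivity) (hT0 f hf)
  · have : ‖T w‖ = ‖T‖ := (hTle.trans (by nlinarith)).antisymm hTw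
    rw [smul_apply, norm_smul, norm_inv, Real.norm_of_nonneg hT.le, this,
      inv_mul_cancel₀ hT.ne']
  · linarith
  · linarith [norm_normalize_sub_le hS hc hT]

end Main

end BPBPositive

theorem mainTheorem4 :
    (∀ (L : Type u) [TopologicalSpace L] [LocallyCompactSpace L] [T2Space L]
        [TopologicalSpace.SeparableSpace C₀(L, ℝ)]
        (Y : Type v) [NormedAddCommGroup Y] [NormedSpace ℝ Y] [CompleteSpace Y]
        [Lattice Y] [IsOrderedAddMonoid Y] [IsOrderedModule ℝ Y] [HasSolidNorm Y],
        BPBPositive.UniformlyMonotone Y → BPBPositive.BPBpPositive C₀(L, ℝ) Y) ∧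
    (∀ δ : ℝ → ℝ, ∃ η : ℝ → ℝ, (∀ ε : ℝ, 0 < ε → ε < 1 → 0 < η ε ∧ η ε < ε) ∧
      ∀ (L : Type u) [TopologicalSpace L] [LocallyCompactSpace L] [T2Space L]
        [TopologicalSpace.SeparableSpace C₀(L, ℝ)]
        (Y : Type v) [NormedAddCommGroup Y] [NormedSpace ℝ Y] [CompleteSpace Y]
        [Lattice Y] [IsOrderedAddMonoid Y] [IsOrderedModule ℝ Y] [HasSolidNorm Y],
        BPBPositive.IsModulusOfUniformMonotonicity Y δ →
          ∀ ε : ℝ, 0 < ε → ε < 1 → BPBPositive.BPBpPositiveAt C₀(L, ℝ) Y ε (η ε)) := by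
  have hlt : ∀ ε : ℝ, 0 < ε → ε < 1 → ε ^ 2 / 32 < ε := fun ε h0 h1 => by nlinarith
  -- Since `δ` is arbitrary, the default `ε / 2` keeps `0 < η ε < ε` where `δ` cannot be a modulus;
  -- for a genuine modulus the first branch always applies.
  refine ⟨?_, fun δ => ⟨fun ε => if 0 < δ (ε ^ 2 / 32) ∧ δ (ε ^ 2 / 32) ≤ ε ^ 2 / 32 then
    δ (ε ^ 2 / 32) / 2 else ε / 2, ?_, ?_⟩⟩
  · intro L _ _ _ _ Y _ _ _ _ _ _ _ hY ε hε hε1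
    have hγ := hlt ε hε hε1
    obtain ⟨δ, hδ, hδγ, hUM⟩ := hY (ε ^ 2 / 32) (by positivity) (hγ.trans hε1)
    exact ⟨δ / 2, by linarith, by linarith,
      BPBPositive.bpbpPositiveAt_of_uniformMonotonicityAt hY hε hε1 hδ (by linarith) hUM⟩
  · intro ε hε hε1
    have hγ := hlt ε hε hε1
    dsimp only
    split_ifs with h
    · exact ⟨by linarith [h.1], by linarith [h.1, h.2]⟩
    · exact ⟨by linarith, by linarith⟩
  · intro L _ _ _ _ Y _ _ _ _ _ _ _ hδY ε hε hε1
    have hγ := hlt ε hε hε1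
    have hY : BPBPositive.UniformlyMonotone Y := fun ε h0 h1 => ⟨δ ε, hδY ε h0 h1⟩
    obtain ⟨hδ, hδγ, hUM⟩ := hδY (ε ^ 2 / 32) (by positivity) (hγ.trans hε1)
    dsimp only
    rw [if_pos ⟨hδ, hδγ⟩]
    exact BPBPositive.bpbpPositiveAt_of_uniformMonotonicityAt hY hε hε1 hδ (by linarith) hUM
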